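/- All graphs are finite. A $t$-tree is a graph obtained from a $t$-clique by iteratively adding vertices whose neighborhood, at the moment they are added, is a $t$-clique. The treewidth of $G$ is the least $t$ such that $G$ is a subgraph of a $t$-tree, and $\omega(G)$ is the number of vertices in a largest clique of $G$. A fractional coloring of $G$ assigns to each vertex $v$ a Lebesgue measurable set $\phi(v)\subseteq\mathbb R$ of measure $1$ so that $\phi(u)\cap\phi(v)=\emptyset$ for every edge $uv$. The fractional chromatic number $\chi_f(G)$ is the infimum of the Lebesgue measure of $\bigcup_{v}\phi(v)$ over all fractional colorings $\phi$ of $G$. Let $t\ge 1$ and $\omega\ge 2$ be integers with $\frac{t+1}{2}\le\omega\le t$. Then there exists a graph $G$ of treewidth $t$ and clique number $\omega$ satisfying \[\chi_f(G)\;\ge\; t+1-\sum_{i=1}^{t-\omega+1}\frac{1}{\omega-i+1}.\] Moreover, if $\omega=t$, then $t+1-\frac1t$ is the maximum of $\chi_f(G)$ over all graphs $G$ of treewidth $t$ and clique number $t$; that is, $\chi_f(G)\le t+1-\frac1t$ for all such graphs, with equality for some such graph. -/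

import Mathlib

namespace SimpleGraph

/-- `IsKTreeOn t s G`: the graph `G`, whose edges all lie inside the finite vertex set `s`, is a
`t`-tree with vertex set `s`. One starts with a `t`-clique and iteratively adds a new vertex `v`
whose neighborhood at that moment is a `t`-clique `K` of the graph built so far. -/
inductive IsKTreeOn {V : Type*} (t : ℕ) : Finset V → SimpleGraph V → Prop
  | clique (s : Finset V) (hs : s.card = t) :
      IsKTreeOn t s (SimpleGraph.fromRel (fun a b => a ∈ s ∧ b ∈ s))
  | addVertex {s : Finset V} {H : SimpleGraph V} (hH : IsKTreeOn t s H)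
      (v : V) (hv : v ∉ s) (K : Finset V) (hKs : K ⊆ s) (hK : H.IsNClique t K) :
      IsKTreeOn t (Finset.cons v s hv) (H ⊔ SimpleGraph.fromRel (fun a b => a = v ∧ b ∈ K))

/-- `G` is a `t`-tree (on its whole vertex type, which is then finite). -/
def IsKTree {V : Type*} (t : ℕ) (G : SimpleGraph V) : Prop :=
  ∃ s : Finset V, (∀ v, v ∈ s) ∧ IsKTreeOn t s G

/-- A partial `t`-tree is (isomorphic to) a not necessarily induced or spanning subgraph of a
`t`-tree. As `t`-trees are finite, it is enough to look at those on `Fin n`. -/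
def IsPartialKTree {V : Type*} (t : ℕ) (G : SimpleGraph V) : Prop :=
  ∃ (n : ℕ) (H : SimpleGraph (Fin n)), IsKTree t H ∧ G.IsContained H

/-- The treewidth of a finite graph: the least `t` for which it is a partial `t`-tree. -/
noncomputable def treewidth {V : Type*} (G : SimpleGraph V) : ℕ :=
  sInf {t : ℕ | IsPartialKTree t G}

/-- A fractional coloring: every vertex gets a Lebesgue measurable set of reals of Lebesgue
measure `1`, and adjacent vertices get disjoint sets. (`NullMeasurableSet` for `volume` is
Lebesgue measurability.) -/
structure IsFractionalColoring {V : Type*} (G : SimpleGraph V) (φ : V → Set ℝ) : Prop where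
  measurable : ∀ v, MeasureTheory.NullMeasurableSet (φ v) MeasureTheory.volume
  measure_eq_one : ∀ v, MeasureTheory.volume (φ v) = 1
  disjoint : ∀ u v, G.Adj u v → Disjoint (φ u) (φ v)

/-- The fractional chromatic number of a finite graph: the infimum of the measure of the set of
all used colors, over all fractional colorings. -/
noncomputable def fractionalChromaticNumber {V : Type*} (G : SimpleGraph V) : ℝ :=
  sInf {x : ℝ | ∃ φ : V → Set ℝ, G.IsFractionalColoring φ ∧
    x = (MeasureTheory.volume (⋃ v, φ v)).toReal}

end SimpleGraph

/-! Upper bound. Let `G` be a subgraph of a `t`-tree `H`, without `(t+1)`-cliques. Give every vertex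
`t` of `t ^ 2 + t - 1` colors so that an edge of `H` has disjoint color sets at its ends if it lies
in `G`, and exactly one common color otherwise. Such a coloring extends along the construction of
`H` (`exists_finset_inter_card_eq_one`): a new vertex takes one private color from each non-neighbor
in its clique and fills up with fresh colors. There are enough fresh colors unless the new vertex
and its `t`-clique form a `(t+1)`-clique of `G`. Dividing by `t` gives `t + 1 - 1 / t`.

Lower bound. Build levels of partial `t`-trees in which every admissible attachment to a `t`-clique
of level `d` occurs in level `d + 1` (`exists_isUniversalTower`). Against a given fractional
coloring, grow a set `S` by pairs (`exists_large_biUnion`). When `S` has `2 * i` vertices and clique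
number at most `i`, attach `v` to all of `S`, then a clique `W` of `ω - i` vertices joined to `S`
but not to `v`. Since `W` is a clique, some `w ∈ W` shares at most `1 / (ω - i)` with `v`. Adding
the nonadjacent pair `v`, `w` raises the clique number by at most one and the measure by at least `2
- 1 / (ω - i)`. After `t - ω + 1` rounds a clique joined to `S` brings the total to `t + 1`
vertices. The level needed does not depend on the coloring, so one finite graph suffices. A copy of
`K_{t,t}` keeps its treewidth from dropping below `t`. -/

namespace SimpleGraph

variable {V : Type*}

/-! ### Upper bound: overlapping `t`-fold colorings along a `t`-tree -/

section OverlapColoring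

/-- Given at most `t` sets of `t` colors that meet pairwise in at most one color, there is a new
set of `t` colors that meets the sets indexed by `N` in exactly one color and avoids the others. -/
theorem exists_finset_inter_card_eq_one [DecidableEq V] {t : ℕ} (ht : 1 ≤ t) (K N : Finset V)
    (hN : N ⊆ K) (f : V → Finset ℕ) (hKt : K.card ≤ t) (hf : ∀ k ∈ K, (f k).card = t)
    (hfr : ∀ k ∈ K, f k ⊆ Finset.range (t ^ 2 + t - 1))
    (hpair : ∀ j ∈ K, ∀ k ∈ K, j ≠ k → (f j ∩ f k).card ≤ 1)
    (hfull : K.card = t → N.Nonempty ∨ ∃ a ∈ K, ∃ b ∈ K, a ≠ b ∧ (f a ∩ f b).Nonempty) :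
    ∃ A ⊆ Finset.range (t ^ 2 + t - 1), A.card = t ∧ (∀ k ∈ N, (A ∩ f k).card = 1) ∧
      ∀ k ∈ K, k ∉ N → Disjoint A (f k) := by
  -- The other sets meet `f k` in at most `K.card - 1 < t` colors altogether, so `f k` has a private
  -- color.
  have hpriv : ∀ k, ∃ c, k ∈ K → c ∈ f k ∧ ∀ j ∈ K, j ≠ k → c ∉ f j := by
    intro k
    by_cases hk : k ∈ K
    · have h1 : ((K.erase k).biUnion fun j => f k ∩ f j).card < (f k).card := by
        calc _ ≤ ∑ j ∈ K.erase k, (f k ∩ f j).card := Finset.card_biUnion_le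
          _ ≤ ∑ j ∈ K.erase k, 1 := Finset.sum_le_sum fun j hj =>
              hpair k hk j (Finset.mem_of_mem_erase hj) (Finset.ne_of_mem_erase hj).symm
          _ = K.card - 1 := by simp [Finset.card_erase_of_mem hk]
          _ < (f k).card := by rw [hf k hk]; omega
      obtain ⟨c, hc, hc'⟩ := Finset.exists_mem_notMem_of_card_lt_card h1
      refine ⟨c, fun _ => ⟨hc, fun j hj hjk hcj => hc' ?_⟩⟩
      simp only [Finset.mem_biUnion, Finset.mem_erase, Finset.mem_inter]
      exact ⟨j, ⟨hjk, hj⟩, hc, hcj⟩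
    · exact ⟨0, fun h => absurd h hk⟩
  choose c hc using hpriv
  have hinj : Set.InjOn c N := by
    intro a ha b hb hab
    by_contra hne
    exact (hc a (hN ha)).2 b (hN hb) (Ne.symm hne) (hab ▸ (hc b (hN hb)).1)
  have hBcard : (N.image c).card = N.card := Finset.card_image_of_injOn hinj
  have hNt : N.card ≤ t := (Finset.card_le_card hN).trans hKt
  have hU : (K.biUnion f).card ≤ K.card * t := Finset.card_biUnion_le_card_mul _ _ _
    fun k hk => (hf k hk).le
  -- The critical case is `K.card = t`. The union has at most `t * t` colors, leaving `t - 1`, which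
  -- suffices if `N` is nonempty. Otherwise an overlapping pair costs the union one color, and `t`
  -- are left.
  have hR : t - N.card ≤ (Finset.range (t ^ 2 + t - 1) \ K.biUnion f).card := by
    have h0 := Finset.le_card_sdiff (K.biUnion f) (Finset.range (t ^ 2 + t - 1))
    rw [Finset.card_range] at h0
    rcases hKt.lt_or_eq with hlt | heq
    · have h2 : (K.card + 1) * t ≤ t * t := Nat.mul_le_mul_right t hlt
      have h3 : t ^ 2 = t * t := sq t
      have h4 : (K.card + 1) * t = K.card * t + t := by ring
      omega
    · have h3 : t ^ 2 = t * t := sq t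
      rw [heq] at hU
      rcases hfull heq with hNe | ⟨a, ha, b, hb, hab, hne⟩
      · have := hNe.card_pos
        omega
      · have hlt : (K.biUnion f).card < t * t := by
          have hKa : K.biUnion f = f a ∪ (K.erase a).biUnion f := by
            rw [← Finset.biUnion_insert, Finset.insert_erase ha]
          have hbsub : f b ⊆ (K.erase a).biUnion f :=
            Finset.subset_biUnion_of_mem f (Finset.mem_erase.2 ⟨hab.symm, hb⟩)
          have h5 := Finset.card_union_add_card_inter (f a) ((K.erase a).biUnion f)
          have h6 : 0 < (f a ∩ (K.erase a).biUnion f).card :=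
            (hne.mono (Finset.inter_subset_inter_left hbsub)).card_pos
          have h7 : ((K.erase a).biUnion f).card ≤ (K.erase a).card * t :=
            Finset.card_biUnion_le_card_mul _ _ _ fun k hk => (hf k (Finset.mem_of_mem_erase hk)).le
          have h8 : (K.erase a).card + 1 = t := by rw [Finset.card_erase_add_one ha, heq]
          have h9 : (K.erase a).card * t + t = t * t := by
            rw [← Nat.succ_mul, Nat.succ_eq_add_one, h8]
          rw [hKa]
          have := hf a ha
          omega
        omega
  obtain ⟨A₀, hA₀, hA₀c⟩ := Finset.exists_subset_card_eq hR
  have hA₀f : ∀ k ∈ K, ∀ x ∈ A₀, x ∉ f k := fun k hk x hx hxk =>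
    (Finset.mem_sdiff.1 (hA₀ hx)).2 (Finset.mem_biUnion.2 ⟨k, hk, hxk⟩)
  have hdis : Disjoint (N.image c) A₀ := by
    rw [Finset.disjoint_left]
    intro x hx hx'
    obtain ⟨k, hk, rfl⟩ := Finset.mem_image.1 hx
    exact hA₀f k (hN hk) _ hx' (hc k (hN hk)).1
  refine ⟨N.image c ∪ A₀, ?_, ?_, ?_, ?_⟩
  · refine Finset.union_subset ?_ (hA₀.trans Finset.sdiff_subset)
    intro x hx
    obtain ⟨k, hk, rfl⟩ := Finset.mem_image.1 hx
    exact hfr k (hN hk) (hc k (hN hk)).1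
  · rw [Finset.card_union_of_disjoint hdis, hBcard, hA₀c]
    omega
  · intro k hk
    rw [Finset.card_eq_one]
    refine ⟨c k, ?_⟩
    ext x
    simp only [Finset.mem_inter, Finset.mem_union, Finset.mem_image, Finset.mem_singleton]
    constructor
    · rintro ⟨⟨j, hj, rfl⟩ | hx, hxk⟩
      · by_contra hne
        exact (hc j (hN hj)).2 k (hN hk) (fun h => hne (by rw [h])) hxk
      · exact absurd hxk (hA₀f k (hN hk) x hx)
    · rintro rfl
      exact ⟨Or.inl ⟨k, hk, rfl⟩, (hc k (hN hk)).1⟩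
  · intro k hk hkN
    rw [Finset.disjoint_left]
    intro x hx hxk
    rcases Finset.mem_union.1 hx with hx | hx
    · obtain ⟨j, hj, rfl⟩ := Finset.mem_image.1 hx
      exact (hc j (hN hj)).2 k hk (fun h => hkN (h ▸ hj)) hxk
    · exact hA₀f k hk x hx hxk

/-- A `t`-fold coloring of `s` with `t ^ 2 + t - 1` colors in which the ends of each edge of `H`
share no color if they are adjacent in `G`, and exactly one color otherwise. -/
structure IsOverlapColoring (t : ℕ) (s : Finset V) (H G : SimpleGraph V)
    (f : V → Finset ℕ) : Prop where
  subset_range : ∀ v ∈ s, f v ⊆ Finset.range (t ^ 2 + t - 1)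
  card_eq : ∀ v ∈ s, (f v).card = t
  disjoint : ∀ a ∈ s, ∀ b ∈ s, H.Adj a b → G.Adj a b → Disjoint (f a) (f b)
  card_inter : ∀ a ∈ s, ∀ b ∈ s, H.Adj a b → ¬ G.Adj a b → ((f a).filter (· ∈ f b)).card = 1

/-- Here it matters that nonadjacent ends share exactly one color, not at most one: if `v` is joined
to all of a `t`-set `K`, clique-freeness gives a nonadjacent pair in `K`, and its common color frees
the color that `v` needs. -/
theorem IsOverlapColoring.exists_extension {t : ℕ} (ht : 1 ≤ t) {s : Finset V}
    {H G : SimpleGraph V} {f : V → Finset ℕ} (hf : IsOverlapColoring t s H G f)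
    {v : V} (hv : v ∉ s) {K : Finset V} (hKs : K ⊆ s) (hK : H.IsClique (K : Set V))
    (hKt : K.card ≤ t) (hG : G.CliqueFree (t + 1)) (hH : ∀ a b, H.Adj a b → a ∈ s) :
    ∃ f', IsOverlapColoring t (Finset.cons v s hv)
      (H ⊔ SimpleGraph.fromRel (fun a b => a = v ∧ b ∈ K)) G f' := by
  classical
  obtain ⟨A, hAr, hAc, hA1, hA0⟩ := exists_finset_inter_card_eq_one ht K
    (K.filter fun k => ¬ G.Adj v k) (Finset.filter_subset _ _) f hKt
    (fun k hk => hf.card_eq k (hKs hk)) (fun k hk => hf.subset_range k (hKs hk))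
    (by
      intro j hj k hk hjk
      have hadj : H.Adj j k := hK hj hk hjk
      by_cases hg : G.Adj j k
      · rw [Finset.disjoint_iff_inter_eq_empty.1 (hf.disjoint j (hKs hj) k (hKs hk) hadj hg)]
        simp
      · have := hf.card_inter j (hKs hj) k (hKs hk) hadj hg
        rw [Finset.filter_mem_eq_inter] at this
        exact this.le)
    (by
      intro hKc
      by_contra! hcon
      obtain ⟨h1, h2⟩ := hcon
      rw [Finset.filter_eq_empty_iff] at h1
      refine hG (insert v K) (IsNClique.insert ?_ fun b hb => not_not.1 (h1 hb))
      refine ⟨fun a ha b hb hab => ?_, hKc⟩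
      by_contra hg
      have := hf.card_inter a (hKs ha) b (hKs hb) (hK ha hb hab) hg
      rw [Finset.filter_mem_eq_inter, h2 a ha b hb hab] at this
      simp at this)
  have hne : ∀ a ∈ s, a ≠ v := fun a ha h => hv (h ▸ ha)
  have hnew : ∀ b, (H ⊔ SimpleGraph.fromRel (fun a b => a = v ∧ b ∈ K)).Adj v b → b ∈ K := by
    intro b hb
    rw [sup_adj, fromRel_adj] at hb
    rcases hb with hb | ⟨h1, ⟨-, h2⟩ | ⟨rfl, h2⟩⟩
    · exact absurd (hH _ _ hb) hv
    · exact h2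
    · exact h2
  have hold : ∀ a ∈ s, ∀ b ∈ s,
      (H ⊔ SimpleGraph.fromRel (fun a b => a = v ∧ b ∈ K)).Adj a b → H.Adj a b := by
    intro a ha b hb hab
    rw [sup_adj, fromRel_adj] at hab
    rcases hab with hab | ⟨-, ⟨h, -⟩ | ⟨h, -⟩⟩
    · exact hab
    · exact absurd h (hne a ha)
    · exact absurd h (hne b hb)
  have hfs : ∀ a ∈ s, Function.update f v A a = f a := fun a ha =>
    Function.update_of_ne (hne a ha) _ _
  have hfv : Function.update f v A v = A := Function.update_self ..
  refine ⟨Function.update f v A, ?_, ?_, ?_, ?_⟩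
  · intro a ha
    rcases Finset.mem_cons.1 ha with rfl | ha
    · rwa [hfv]
    · rw [hfs a ha]; exact hf.subset_range a ha
  · intro a ha
    rcases Finset.mem_cons.1 ha with rfl | ha
    · rwa [hfv]
    · rw [hfs a ha]; exact hf.card_eq a ha
  · intro a ha' b hb' hab hg
    rcases Finset.mem_cons.1 ha' with rfl | ha <;> rcases Finset.mem_cons.1 hb' with rfl | hb
    · exact absurd hab (SimpleGraph.irrefl _)
    · rw [hfv, hfs b hb]
      exact hA0 b (hnew b hab) (by simp [hg])
    · rw [hfv, hfs a ha]
      exact (hA0 a (hnew a hab.symm) (by simp [hg.symm])).symm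
    · rw [hfs a ha, hfs b hb]
      exact hf.disjoint a ha b hb (hold a ha b hb hab) hg
  · intro a ha' b hb' hab hg
    rcases Finset.mem_cons.1 ha' with rfl | ha <;> rcases Finset.mem_cons.1 hb' with rfl | hb
    · exact absurd hab (SimpleGraph.irrefl _)
    · rw [hfv, hfs b hb, Finset.filter_mem_eq_inter]
      exact hA1 b (by simp [hg, hnew b hab])
    · rw [hfv, hfs a ha, Finset.filter_mem_eq_inter, Finset.inter_comm]
      exact hA1 a (Finset.mem_filter.2 ⟨hnew a hab.symm, fun h => hg h.symm⟩)
    · rw [hfs a ha, hfs b hb]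
      exact hf.card_inter a ha b hb (hold a ha b hb hab) hg

theorem IsKTreeOn.mem_of_adj {t : ℕ} {s : Finset V} {H : SimpleGraph V} (h : IsKTreeOn t s H) :
    ∀ a b, H.Adj a b → a ∈ s := by
  induction h with
  | clique s hs =>
    intro a b hab
    rw [fromRel_adj] at hab
    tauto
  | addVertex hH v hv K hKs hK ih =>
    intro a b hab
    rw [sup_adj, fromRel_adj] at hab
    rw [Finset.mem_cons]
    rcases hab with hab | ⟨-, ⟨h, -⟩ | ⟨-, h⟩⟩
    · exact Or.inr (ih a b hab)
    · exact Or.inl h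
    · exact Or.inr (hKs h)

theorem IsKTreeOn.exists_isOverlapColoring {t : ℕ} (ht : 1 ≤ t) {s : Finset V}
    {H G : SimpleGraph V} (h : IsKTreeOn t s H) (hG : G.CliqueFree (t + 1)) :
    ∃ f, IsOverlapColoring t s H G f := by
  induction h with
  | clique s hs =>
    -- The initial clique is colored by the same extension step, each vertex being attached to all
    -- earlier ones.
    have key : ∀ s : Finset V, s.card ≤ t → ∃ f, IsOverlapColoring t s
        (SimpleGraph.fromRel (fun a b => a ∈ s ∧ b ∈ s)) G f := by
      intro s
      induction s using Finset.cons_induction with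
      | empty => exact fun _ => ⟨fun _ => ∅, by simp, by simp, by simp, by simp⟩
      | cons v s hv ih =>
        intro hc
        rw [Finset.card_cons] at hc
        obtain ⟨f, hf⟩ := ih (by omega)
        obtain ⟨f', hf'⟩ := hf.exists_extension ht hv subset_rfl
          (fun a ha b hb hab => by
            rw [fromRel_adj]
            exact ⟨hab, Or.inl ⟨ha, hb⟩⟩) (by omega) hG
          (fun a b hab => by
            rw [fromRel_adj] at hab
            tauto)
        refine ⟨f', ?_⟩
        convert hf' using 1
        ext a b
        simp only [fromRel_adj, sup_adj, Finset.mem_cons]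
        constructor
        · rintro ⟨hne, h⟩
          by_cases hav : a = v
          · subst hav
            right
            have : b ∈ s := by
              rcases h with ⟨-, h | h⟩ | ⟨h | h, -⟩
              · exact absurd h.symm hne
              · exact h
              · exact absurd h.symm hne
              · exact h
            exact ⟨hne, Or.inl ⟨rfl, this⟩⟩
          · tauto
        · tauto
    exact key s hs.le
  | addVertex hH v hv K hKs hK ih =>
    obtain ⟨f, hf⟩ := ih
    exact hf.exists_extension ht hv hKs hK.isClique hK.card_eq.le hG hH.mem_of_adj

end OverlapColoring

/-! ### Fractional chromatic number: bounds from multicolorings -/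

section FractionalChromaticNumber

open MeasureTheory

theorem fractionalChromaticNumber_le [Finite V] {G : SimpleGraph V} {φ : V → Set ℝ}
    (h : G.IsFractionalColoring φ) :
    G.fractionalChromaticNumber ≤ (volume (⋃ v, φ v)).toReal :=
  csInf_le ⟨0, by rintro x ⟨φ, -, rfl⟩; exact ENNReal.toReal_nonneg⟩ ⟨φ, h, rfl⟩

theorem volume_biUnion_Ico_div {b : ℕ} (hb : 0 < b) (A : Finset ℕ) :
    volume (⋃ c ∈ A, Set.Ico ((c : ℝ) / b) ((c + 1 : ℝ) / b)) = ENNReal.ofReal (A.card / b) := by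
  have hb' : (0 : ℝ) < b := by exact_mod_cast hb
  rw [measure_biUnion_finset]
  · have : ∀ c : ℕ, volume (Set.Ico ((c : ℝ) / b) ((c + 1 : ℝ) / b)) = ENNReal.ofReal (1 / b) := by
      intro c
      rw [Real.volume_Ico]
      congr 1
      ring
    simp only [this, Finset.sum_const, nsmul_eq_mul]
    rw [← ENNReal.ofReal_natCast, ← ENNReal.ofReal_mul (by positivity)]
    congr 1
    ring
  · intro c _ d _ hcd
    rw [Function.onFun, Set.disjoint_left]
    rintro x ⟨h1, h2⟩ ⟨h3, h4⟩
    rw [div_le_iff₀ hb'] at h1 h3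
    rw [lt_div_iff₀ hb'] at h2 h4
    have h5 : (c : ℝ) < d + 1 := h1.trans_lt h4
    have h6 : (d : ℝ) < c + 1 := h3.trans_lt h2
    norm_cast at h5 h6
    omega
  · intro c _
    exact measurableSet_Ico

/-- A `b`-fold coloring with `a` colors bounds the fractional chromatic number by `a / b`. -/
theorem fractionalChromaticNumber_le_div [Finite V] {G : SimpleGraph V} {a b : ℕ} (hb : 0 < b)
    (f : V → Finset ℕ) (hr : ∀ v, f v ⊆ Finset.range a) (hc : ∀ v, (f v).card = b)
    (hd : ∀ u v, G.Adj u v → Disjoint (f u) (f v)) :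
    G.fractionalChromaticNumber ≤ (a : ℝ) / b := by
  have hb' : (0 : ℝ) < b := by exact_mod_cast hb
  have hφ : G.IsFractionalColoring
      (fun v => ⋃ c ∈ f v, Set.Ico ((c : ℝ) / b) ((c + 1 : ℝ) / b)) := by
    refine ⟨fun v => ?_, fun v => ?_, fun u v huv => ?_⟩
    · exact (Finset.measurableSet_biUnion _ fun _ _ => measurableSet_Ico).nullMeasurableSet
    · rw [volume_biUnion_Ico_div hb, hc, div_self hb'.ne', ENNReal.ofReal_one]
    · rw [Set.disjoint_left]
      intro x hx hy
      simp only [Set.mem_iUnion] at hx hy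
      obtain ⟨c, hcu, h1, h2⟩ := hx
      obtain ⟨d, hdv, h3, h4⟩ := hy
      rw [div_le_iff₀ hb'] at h1 h3
      rw [lt_div_iff₀ hb'] at h2 h4
      have h5 : (c : ℝ) < d + 1 := h1.trans_lt h4
      have h6 : (d : ℝ) < c + 1 := h3.trans_lt h2
      norm_cast at h5 h6
      have : c = d := by omega
      subst this
      exact Finset.disjoint_left.1 (hd u v huv) hcu hdv
  refine (fractionalChromaticNumber_le hφ).trans ?_
  have hsub : (⋃ v, ⋃ c ∈ f v, Set.Ico ((c : ℝ) / b) ((c + 1 : ℝ) / b)) ⊆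
      ⋃ c ∈ Finset.range a, Set.Ico ((c : ℝ) / b) ((c + 1 : ℝ) / b) :=
    Set.iUnion_subset fun v => Set.biUnion_subset_biUnion_left (hr v)
  have hvol := volume_biUnion_Ico_div hb (Finset.range a)
  rw [Finset.card_range] at hvol
  have h1 := measure_mono (μ := volume) hsub
  rw [hvol] at h1
  exact ENNReal.toReal_le_of_le_ofReal (by positivity) h1

/-- Disjoint unit intervals serve every graph. This makes the set under the infimum nonempty, as
lower bounds on `sInf` require. -/
theorem exists_isFractionalColoring_nat (G : SimpleGraph ℕ) :
    ∃ φ, G.IsFractionalColoring φ := by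
  refine ⟨fun v => Set.Ico (v : ℝ) (v + 1), fun v => measurableSet_Ico.nullMeasurableSet,
    fun v => by simp, fun u v huv => ?_⟩
  rw [Set.disjoint_left]
  rintro x ⟨h1, h2⟩ ⟨h3, h4⟩
  have h5 : (u : ℝ) < v + 1 := h1.trans_lt h4
  have h6 : (v : ℝ) < u + 1 := h3.trans_lt h2
  norm_cast at h5 h6
  exact huv.ne (by omega)

theorem le_fractionalChromaticNumber {n : ℕ} {G : SimpleGraph (Fin n)} {x : ℝ}
    (h : ∀ φ, G.IsFractionalColoring φ → x ≤ (volume (⋃ v, φ v)).toReal) :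
    x ≤ G.fractionalChromaticNumber := by
  refine le_csInf ?_ (by rintro _ ⟨φ, hφ, rfl⟩; exact h φ hφ)
  obtain ⟨φ, hφ⟩ := exists_isFractionalColoring_nat (G.map Fin.valEmbedding)
  exact ⟨_, fun v => φ v, ⟨fun v => hφ.measurable _, fun v => hφ.measure_eq_one _,
    fun u v huv => hφ.disjoint _ _ ((map_adj Fin.valEmbedding G _ _).2 ⟨u, v, huv, rfl, rfl⟩)⟩, rfl⟩

/-- A partial `t`-tree without a clique of `t + 1` vertices has fractional chromatic number at
most `t + 1 - 1 / t`. -/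
theorem IsPartialKTree.fractionalChromaticNumber_le {t : ℕ} (ht : 1 ≤ t) {G : SimpleGraph V}
    (h : IsPartialKTree t G) (hG : G.CliqueFree (t + 1)) :
    G.fractionalChromaticNumber ≤ (t : ℝ) + 1 - 1 / t := by
  obtain ⟨n, H, ⟨s, hs, hH⟩, ⟨φ⟩⟩ := h
  have hfin : Finite V := Finite.of_injective _ φ.injective
  let e : V ↪ Fin n := ⟨φ, φ.injective⟩
  have hG' : (G.map e).CliqueFree (t + 1) := by
    rcases isEmpty_or_nonempty V with hV | hV
    · have : G.map e = ⊥ := by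
        ext a b
        rw [map_adj e G a b, bot_adj, iff_false]
        rintro ⟨u, -⟩
        exact hV.elim u
      rw [this]
      exact cliqueFree_bot (by omega)
    · exact (cliqueFree_map_iff (f := e)).2 hG
  obtain ⟨f, hf⟩ := hH.exists_isOverlapColoring ht hG'
  have h1 := fractionalChromaticNumber_le_div (G := G) (a := t ^ 2 + t - 1) (by omega : 0 < t)
    (fun v => f (φ v)) (fun v => hf.subset_range _ (hs _)) (fun v => hf.card_eq _ (hs _))
    (fun u v huv => hf.disjoint _ (hs _) _ (hs _) (φ.toHom.map_adj huv)
      ((map_adj e G _ _).2 ⟨u, v, huv, rfl, rfl⟩))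
  refine h1.trans (le_of_eq ?_)
  have ht' : (t : ℝ) ≠ 0 := by positivity
  rw [Nat.cast_sub (by nlinarith)]
  push_cast
  field_simp

end FractionalChromaticNumber

end SimpleGraph

namespace SimpleGraph

/-! ### The universal tower of partial `t`-trees -/

section UniversalTower

theorem cliqueFreeOn_insert {V : Type*} [DecidableEq V] {G : SimpleGraph V} {A : Finset V} {n : ℕ}
    (h : G.CliqueFreeOn (A : Set V) n) (v : V) :
    G.CliqueFreeOn ((insert v A : Finset V) : Set V) (n + 1) := by
  intro Q hQ hc
  rw [Finset.coe_subset] at hQ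
  by_cases hv : v ∈ Q
  · refine h (t := Q.erase v) ?_ ⟨hc.isClique.subset (by simp), by
      rw [Finset.card_erase_of_mem hv, hc.card_eq, Nat.add_sub_cancel]⟩
    rw [Finset.coe_subset]
    exact (Finset.erase_subset_erase v hQ).trans (Finset.erase_insert_subset v A)
  · exact h.mono G n.le_succ (fun x hx => Finset.mem_of_mem_insert_of_ne (hQ hx)
      (fun h => hv (h ▸ hx))) hc

/-- A graph on a finite set of natural numbers without cliques of `ω + 1` vertices, together with
a `t`-tree containing it. -/
structure CliqueFreePartialKTree (t ω : ℕ) where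
  verts : Finset ℕ
  tree : SimpleGraph ℕ
  graph : SimpleGraph ℕ
  isKTreeOn : IsKTreeOn t verts tree
  graph_le : graph ≤ tree
  cliqueFree : graph.CliqueFree (ω + 1)

namespace CliqueFreePartialKTree

variable {t ω : ℕ}

/-- `P` is the part of `Q` induced on the vertices of `P`. -/
def IsInducedIn (P Q : CliqueFreePartialKTree t ω) : Prop :=
  P.verts ⊆ Q.verts ∧
    (∀ a ∈ P.verts, ∀ b ∈ P.verts, Q.tree.Adj a b ↔ P.tree.Adj a b) ∧
    ∀ a ∈ P.verts, ∀ b ∈ P.verts, Q.graph.Adj a b ↔ P.graph.Adj a b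

theorem IsInducedIn.refl (P : CliqueFreePartialKTree t ω) : P.IsInducedIn P :=
  ⟨subset_rfl, fun _ _ _ _ => Iff.rfl, fun _ _ _ _ => Iff.rfl⟩

theorem IsInducedIn.trans {P Q R : CliqueFreePartialKTree t ω} (h : P.IsInducedIn Q)
    (h' : Q.IsInducedIn R) : P.IsInducedIn R :=
  ⟨h.1.trans h'.1,
    fun a ha b hb => (h'.2.1 a (h.1 ha) b (h.1 hb)).trans (h.2.1 a ha b hb),
    fun a ha b hb => (h'.2.2 a (h.1 ha) b (h.1 hb)).trans (h.2.2 a ha b hb)⟩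

theorem IsInducedIn.isNClique_iff {P Q : CliqueFreePartialKTree t ω} (h : P.IsInducedIn Q) {n : ℕ}
    {K : Finset ℕ} (hK : K ⊆ P.verts) : Q.tree.IsNClique n K ↔ P.tree.IsNClique n K := by
  rw [SimpleGraph.isNClique_iff, SimpleGraph.isNClique_iff]
  refine and_congr_left fun _ => ⟨fun hc a ha b hb hab => ?_, fun hc a ha b hb hab => ?_⟩
  · exact (h.2.1 a (hK ha) b (hK hb)).1 (hc ha hb hab)
  · exact (h.2.1 a (hK ha) b (hK hb)).2 (hc ha hb hab)

theorem IsInducedIn.cliqueFreeOn_iff {P Q : CliqueFreePartialKTree t ω} (h : P.IsInducedIn Q)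
    {n : ℕ} {N : Finset ℕ} (hN : N ⊆ P.verts) :
    Q.graph.CliqueFreeOn (N : Set ℕ) n ↔ P.graph.CliqueFreeOn (N : Set ℕ) n := by
  refine forall_congr' fun K => forall_congr' fun hK => not_congr ?_
  have hK' : K ⊆ P.verts := (Finset.coe_subset.1 hK).trans hN
  rw [SimpleGraph.isNClique_iff, SimpleGraph.isNClique_iff]
  refine and_congr_left fun _ => ⟨fun hc a ha b hb hab => ?_, fun hc a ha b hb hab => ?_⟩
  · exact (h.2.2 a (hK' ha) b (hK' hb)).1 (hc ha hb hab)
  · exact (h.2.2 a (hK' ha) b (hK' hb)).2 (hc ha hb hab)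

/-- A clique of the new graph through the new vertex has all its other members in `N`, hence at most
`ω` vertices. -/
theorem exists_addVertex (P : CliqueFreePartialKTree t ω) {K N : Finset ℕ} (hKs : K ⊆ P.verts)
    (hK : P.tree.IsNClique t K) (hN : N ⊆ K) (hNf : P.graph.CliqueFreeOn (N : Set ℕ) ω) :
    ∃ Q : CliqueFreePartialKTree t ω, P.IsInducedIn Q ∧ ∃ w ∈ Q.verts, w ∉ P.verts ∧
      (∀ k ∈ K, Q.tree.Adj w k) ∧ ∀ k ∈ K, (Q.graph.Adj w k ↔ k ∈ N) := by
  obtain ⟨v, hv⟩ := Infinite.exists_notMem_finset P.verts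
  have hne : ∀ a ∈ P.verts, a ≠ v := fun a ha h => hv (h ▸ ha)
  have hvadj : ∀ b, ¬ P.graph.Adj v b := fun b hb =>
    hv (P.isKTreeOn.mem_of_adj _ _ (P.graph_le hb))
  have hnbr : ∀ k, (P.graph ⊔ fromRel (fun a b => a = v ∧ b ∈ N)).Adj v k → k ∈ N := by
    intro k hk
    rw [sup_adj, fromRel_adj] at hk
    rcases hk with hk | ⟨h1, ⟨-, h2⟩ | ⟨h2, -⟩⟩
    · exact absurd hk (hvadj k)
    · exact h2
    · exact absurd h2.symm h1
  have hold : ∀ (F : SimpleGraph ℕ) (M : Finset ℕ) (a b : ℕ), a ≠ v → b ≠ v →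
      ((F ⊔ fromRel (fun a b => a = v ∧ b ∈ M)).Adj a b ↔ F.Adj a b) := by
    intro F M a b ha hb
    rw [sup_adj, fromRel_adj]
    tauto
  refine ⟨⟨Finset.cons v P.verts hv, P.tree ⊔ fromRel (fun a b => a = v ∧ b ∈ K),
    P.graph ⊔ fromRel (fun a b => a = v ∧ b ∈ N), P.isKTreeOn.addVertex v hv K hKs hK, ?_, ?_⟩,
    ⟨Finset.subset_cons hv, ?_, ?_⟩, v, ?_, hv, ?_, ?_⟩
  · intro a b hab
    rw [sup_adj, fromRel_adj] at hab ⊢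
    have := @P.graph_le a b
    have h2 := @hN a
    have h3 := @hN b
    tauto
  · intro Q hQ
    by_cases hvQ : v ∈ Q
    · refine hNf (t := Q.erase v) (fun x hx => ?_) ⟨fun a ha b hb hab => ?_, ?_⟩
      · rw [Finset.mem_coe, Finset.mem_erase] at hx
        exact hnbr x (hQ.isClique hvQ hx.2 hx.1.symm)
      · rw [Finset.mem_coe, Finset.mem_erase] at ha hb
        exact (hold _ _ _ _ ha.1 hb.1).1 (hQ.isClique ha.2 hb.2 hab)
      · rw [Finset.card_erase_of_mem hvQ, hQ.card_eq, Nat.add_sub_cancel]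
    · refine P.cliqueFree Q ⟨fun a ha b hb hab => ?_, hQ.card_eq⟩
      exact (hold _ _ _ _ (fun h => hvQ (h ▸ ha)) (fun h => hvQ (h ▸ hb))).1
        (hQ.isClique ha hb hab)
  · exact fun a ha b hb => hold _ _ _ _ (hne a ha) (hne b hb)
  · exact fun a ha b hb => hold _ _ _ _ (hne a ha) (hne b hb)
  · simp
  · intro k hk
    rw [sup_adj, fromRel_adj]
    exact Or.inr ⟨(hne k (hKs hk)).symm, Or.inl ⟨rfl, hk⟩⟩
  · intro k hk
    refine ⟨hnbr k, fun hkN => ?_⟩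
    rw [sup_adj, fromRel_adj]
    exact Or.inr ⟨(hne k (hKs hk)).symm, Or.inl ⟨rfl, hkN⟩⟩

/-- Only finitely many pairs `(K, N)` occur. They are treated one by one, and a pair stays
admissible because `P` remains induced in every enlargement. -/
theorem exists_realizing (P : CliqueFreePartialKTree t ω) :
    ∃ Q : CliqueFreePartialKTree t ω, P.IsInducedIn Q ∧ ∀ K N, K ⊆ P.verts →
      P.tree.IsNClique t K → N ⊆ K → P.graph.CliqueFreeOn (N : Set ℕ) ω →
      ∃ w ∈ Q.verts, w ∉ P.verts ∧ (∀ k ∈ K, Q.tree.Adj w k) ∧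
        ∀ k ∈ K, (Q.graph.Adj w k ↔ k ∈ N) := by
  have key : ∀ T : Finset (Finset ℕ × Finset ℕ), ∃ Q : CliqueFreePartialKTree t ω,
      P.IsInducedIn Q ∧ ∀ p ∈ T, p.1 ⊆ P.verts →
      P.tree.IsNClique t p.1 → p.2 ⊆ p.1 → P.graph.CliqueFreeOn (p.2 : Set ℕ) ω →
      ∃ w ∈ Q.verts, w ∉ P.verts ∧ (∀ k ∈ p.1, Q.tree.Adj w k) ∧
        ∀ k ∈ p.1, (Q.graph.Adj w k ↔ k ∈ p.2) := by
    intro T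
    induction T using Finset.cons_induction with
    | empty => exact ⟨P, IsInducedIn.refl P, by simp⟩
    | cons p T hp ih =>
      obtain ⟨Q, hPQ, hQ⟩ := ih
      by_cases hval : p.1 ⊆ P.verts ∧ P.tree.IsNClique t p.1 ∧ p.2 ⊆ p.1 ∧
          P.graph.CliqueFreeOn (p.2 : Set ℕ) ω
      · obtain ⟨h1, h2, h3, h4⟩ := hval
        obtain ⟨R, hQR, w, hw, hwQ, hwt, hwg⟩ := Q.exists_addVertex (h1.trans hPQ.1)
          ((hPQ.isNClique_iff h1).2 h2) h3 ((hPQ.cliqueFreeOn_iff (h3.trans h1)).2 h4)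
        refine ⟨R, hPQ.trans hQR, fun q hq hq1 hq2 hq3 hq4 => ?_⟩
        rcases Finset.mem_cons.1 hq with rfl | hq
        · exact ⟨w, hw, fun h => hwQ (hPQ.1 h), hwt, hwg⟩
        · obtain ⟨u, hu, huP, hut, hug⟩ := hQ q hq hq1 hq2 hq3 hq4
          refine ⟨u, hQR.1 hu, huP, fun k hk => ?_, fun k hk => ?_⟩
          · exact (hQR.2.1 u hu k (hPQ.1 (hq1 hk))).2 (hut k hk)
          · exact (hQR.2.2 u hu k (hPQ.1 (hq1 hk))).trans (hug k hk)
      · refine ⟨Q, hPQ, fun q hq hq1 hq2 hq3 hq4 => ?_⟩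
        rcases Finset.mem_cons.1 hq with rfl | hq
        · exact absurd ⟨hq1, hq2, hq3, hq4⟩ hval
        · exact hQ q hq hq1 hq2 hq3 hq4
  obtain ⟨Q, hPQ, hQ⟩ := key (P.verts.powerset ×ˢ P.verts.powerset)
  refine ⟨Q, hPQ, fun K N hKs hK hN hf => hQ (K, N) ?_ hKs hK hN hf⟩
  simp only [Finset.mem_product, Finset.mem_powerset]
  exact ⟨hKs, hN.trans hKs⟩

end CliqueFreePartialKTree

/-- An infinite graph `G` without cliques of `ω + 1` vertices, exhausted by partial `t`-trees on
the finite sets `s d`, in which every admissible way to attach a new vertex to a `t`-clique of the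
enclosing graph `H` is realized one level up. -/
structure IsUniversalTower (t ω : ℕ) (s : ℕ → Finset ℕ) (H G : SimpleGraph ℕ) : Prop where
  monotone : Monotone s
  exists_isKTreeOn : ∀ d, ∃ H', IsKTreeOn t (s d) H' ∧
    ∀ a ∈ s d, ∀ b ∈ s d, G.Adj a b → H'.Adj a b
  cliqueFreeOn : ∀ d, G.CliqueFreeOn (s d : Set ℕ) (ω + 1)
  exists_isNClique : ∃ K ⊆ s 0, H.IsNClique t K
  exists_attached : ∀ d K N, K ⊆ s d → H.IsNClique t K → N ⊆ K →
    G.CliqueFreeOn (N : Set ℕ) ω → ∃ w ∈ s (d + 1), w ∉ s d ∧ (∀ k ∈ K, H.Adj w k) ∧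
      ∀ k ∈ K, (G.Adj w k ↔ k ∈ N)

theorem exists_isUniversalTower {t ω : ℕ} (hω : 1 ≤ ω) :
    ∃ s H G, IsUniversalTower t ω s H G := by
  choose next hnext hreal using CliqueFreePartialKTree.exists_realizing (t := t) (ω := ω)
  let P₀ : CliqueFreePartialKTree t ω :=
    ⟨Finset.range t, _, ⊥, IsKTreeOn.clique (Finset.range t) (Finset.card_range t), bot_le,
      cliqueFree_bot (by omega)⟩
  let P : ℕ → CliqueFreePartialKTree t ω := fun d => Nat.rec P₀ (fun _ Q => next Q) d
  have hPs : ∀ d, (P d).IsInducedIn (P (d + 1)) := fun d => hnext (P d)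
  have hPle : ∀ d e, d ≤ e → (P d).IsInducedIn (P e) := by
    intro d e hde
    induction e, hde using Nat.le_induction with
    | base => exact .refl _
    | succ e _ ih => exact ih.trans (hPs e)
  have hmono : Monotone fun d => (P d).verts := fun d e hde => (hPle d e hde).1
  -- Stages are induced in later ones, so the union creates no new adjacency among the vertices of a
  -- stage.
  have hH : ∀ d, ∀ a ∈ (P d).verts, ∀ b ∈ (P d).verts,
      ((⨆ e, (P e).tree : SimpleGraph ℕ).Adj a b ↔ (P d).tree.Adj a b) := by
    intro d a ha b hb
    rw [iSup_adj]
    refine ⟨?_, fun h => ⟨d, h⟩⟩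
    rintro ⟨e, he⟩
    rcases le_total e d with hed | hde
    · exact ((hPle e d hed).2.1 a ((P e).isKTreeOn.mem_of_adj _ _ he) b
        ((P e).isKTreeOn.mem_of_adj _ _ he.symm)).2 he
    · exact ((hPle d e hde).2.1 a ha b hb).1 he
  have hG : ∀ d, ∀ a ∈ (P d).verts, ∀ b ∈ (P d).verts,
      ((⨆ e, (P e).graph : SimpleGraph ℕ).Adj a b ↔ (P d).graph.Adj a b) := by
    intro d a ha b hb
    rw [iSup_adj]
    refine ⟨?_, fun h => ⟨d, h⟩⟩
    rintro ⟨e, he⟩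
    rcases le_total e d with hed | hde
    · have he' := (P e).graph_le he
      exact ((hPle e d hed).2.2 a ((P e).isKTreeOn.mem_of_adj _ _ he') b
        ((P e).isKTreeOn.mem_of_adj _ _ he'.symm)).2 he
    · exact ((hPle d e hde).2.2 a ha b hb).1 he
  refine ⟨fun d => (P d).verts, ⨆ e, (P e).tree, ⨆ e, (P e).graph, hmono, fun d => ?_,
    fun d Q hQ hc => ?_, ?_, fun d K N hKs hK hN hf => ?_⟩
  · exact ⟨_, (P d).isKTreeOn, fun a ha b hb hab => (P d).graph_le ((hG d a ha b hb).1 hab)⟩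
  · exact (P d).cliqueFree Q ⟨fun a ha b hb hab =>
      (hG d a (hQ ha) b (hQ hb)).1 (hc.isClique ha hb hab), hc.card_eq⟩
  · refine ⟨Finset.range t, subset_rfl, fun a ha b hb hab => ?_, Finset.card_range t⟩
    refine (hH 0 a ha b hb).2 ?_
    exact (fromRel_adj ..).2 ⟨hab, Or.inl ⟨ha, hb⟩⟩
  · obtain ⟨w, hw, hwd, hwt, hwg⟩ := hreal (P d) K N hKs
      ⟨fun a ha b hb hab => (hH d a (hKs ha) b (hKs hb)).1 (hK.isClique ha hb hab), hK.card_eq⟩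
      hN (fun Q hQ hc => hf hQ ⟨fun a ha b hb hab =>
        (hG d a (hKs (hN (hQ ha))) b (hKs (hN (hQ hb)))).2 (hc.isClique ha hb hab), hc.card_eq⟩)
    refine ⟨w, hw, hwd, fun k hk => ?_, fun k hk => ?_⟩
    · exact (hH (d + 1) w hw k (hmono d.le_succ (hKs hk))).2 (hwt k hk)
    · exact (hG (d + 1) w hw k (hmono d.le_succ (hKs hk))).trans (hwg k hk)

namespace IsUniversalTower

variable {t ω : ℕ} {s : ℕ → Finset ℕ} {H G : SimpleGraph ℕ}

/-- `T` lies in a clique of `H` on level `d` that has at least `t` vertices. -/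
def Extendable (t : ℕ) (s : ℕ → Finset ℕ) (H : SimpleGraph ℕ) (d : ℕ) (T : Finset ℕ) : Prop :=
  ∃ K ⊆ s d, H.IsClique (K : Set ℕ) ∧ t ≤ K.card ∧ T ⊆ K

theorem Extendable.mono {d : ℕ} {T T' : Finset ℕ} (h : Extendable t s H d T) (hT : T' ⊆ T) :
    Extendable t s H d T' := by
  obtain ⟨K, h1, h2, h3, h4⟩ := h
  exact ⟨K, h1, h2, h3, hT.trans h4⟩

theorem extendable_empty (hU : IsUniversalTower t ω s H G) : Extendable t s H 0 ∅ := by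
  obtain ⟨K, hK, hc⟩ := hU.exists_isNClique
  exact ⟨K, hK, hc.isClique, hc.card_eq.ge, by simp⟩

/-- The clique around `T` is shrunk to exactly `t` vertices still containing `T`. With the new
vertex it has `t + 1`, so the enlarged set is again extendable. -/
theorem exists_vertex (hU : IsUniversalTower t ω s H G) {d : ℕ} {T N : Finset ℕ}
    (hT : Extendable t s H d T) (hc : T.card ≤ t) (hN : N ⊆ T)
    (hf : G.CliqueFreeOn (N : Set ℕ) ω) :
    ∃ w ∈ s (d + 1), w ∉ s d ∧ Extendable t s H (d + 1) (insert w T) ∧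
      ∀ k ∈ T, (G.Adj w k ↔ k ∈ N) := by
  obtain ⟨K, hKs, hK, hKt, hTK⟩ := hT
  obtain ⟨K', hTK', hKK', hK'⟩ := Finset.exists_subsuperset_card_eq hTK hc hKt
  have hcl : H.IsNClique t K' := ⟨hK.subset (by exact_mod_cast hKK'), hK'⟩
  obtain ⟨w, hw, hwd, hwt, hwg⟩ := hU.exists_attached d K' N (hKK'.trans hKs) hcl
    (hN.trans hTK') hf
  refine ⟨w, hw, hwd, ⟨insert w K', ?_, ?_, ?_, Finset.insert_subset_insert _ hTK'⟩,
    fun k hk => hwg k (hTK' hk)⟩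
  · exact Finset.insert_subset hw ((hKK'.trans hKs).trans (hU.monotone d.le_succ))
  · exact (hcl.insert hwt).isClique
  · rw [← hK']
    exact Finset.card_le_card (Finset.subset_insert _ _)

/-- Attaching a clique of `k` vertices, all of them with neighborhood `N` in `T`. -/
theorem exists_clique (hU : IsUniversalTower t ω s H G) {d r : ℕ} {T N : Finset ℕ}
    (hT : Extendable t s H d T) (hN : N ⊆ T) (hf : G.CliqueFreeOn (N : Set ℕ) (r + 1)) (k : ℕ)
    (hk : r + k ≤ ω) (hc : T.card + k ≤ t + 1) :
    ∃ W ⊆ s (d + k), Disjoint W (s d) ∧ Extendable t s H (d + k) (T ∪ W) ∧ G.IsNClique k W ∧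
      ∀ w ∈ W, ∀ x ∈ T, (G.Adj w x ↔ x ∈ N) := by
  induction k with
  | zero => exact ⟨∅, by simp, by simp, by simpa using hT, by simp, by simp⟩
  | succ k ih =>
    obtain ⟨W, hWs, hWd, hWe, hW, hWN⟩ := ih (by omega) (by omega)
    have hTs : T ⊆ s d := by
      obtain ⟨K, h1, -, -, h4⟩ := hT
      exact h4.trans h1
    have hcard : (T ∪ W).card ≤ t := by
      have := Finset.card_union_le T W
      rw [hW.card_eq] at this
      omega
    -- The next vertex is joined to `N ∪ W`. Each vertex of `W` raises the clique number by at most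
    -- one, and `r + 1 + k ≤ ω`.
    have hfree : G.CliqueFreeOn ((N ∪ W : Finset ℕ) : Set ℕ) (r + 1 + k) := by
      have : ∀ W : Finset ℕ, G.CliqueFreeOn ((N ∪ W : Finset ℕ) : Set ℕ) (r + 1 + W.card) := by
        intro W
        induction W using Finset.cons_induction with
        | empty => simpa using hf
        | cons w W hw ih =>
          rw [Finset.cons_eq_insert, Finset.union_insert, ← Finset.cons_eq_insert _ _ hw,
            Finset.card_cons, ← add_assoc]
          exact cliqueFreeOn_insert ih w
      rw [← hW.card_eq]
      exact this W
    obtain ⟨w, hw, hwd, hwe, hwg⟩ := hU.exists_vertex hWe hcard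
      (Finset.union_subset_union_left hN) (hfree.mono G (by omega))
    have hnotW : ∀ x ∈ T, x ∉ W := fun x hx hxW => Finset.disjoint_left.1 hWd hxW (hTs hx)
    refine ⟨insert w W, Finset.insert_subset hw (hWs.trans (hU.monotone (Nat.le_succ _))), ?_, ?_,
      ?_, ?_⟩
    · rw [Finset.disjoint_insert_left]
      exact ⟨fun h => hwd (hU.monotone (Nat.le_add_right d k) h), hWd⟩
    · rw [Finset.union_insert]
      exact hwe
    · refine hW.insert fun x hx => (hwg x (Finset.mem_union_right _ hx)).2 ?_
      exact Finset.mem_union_right _ hx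
    · intro u hu x hx
      rcases Finset.mem_insert.1 hu with rfl | hu
      · rw [hwg x (Finset.mem_union_left _ hx), Finset.mem_union]
        exact or_iff_left (hnotW x hx)
      · exact hWN u hu x hx

end IsUniversalTower

end UniversalTower

end SimpleGraph

namespace SimpleGraph

/-! ### Degeneracy of `t`-trees and lower bounds on treewidth -/

section Treewidth

variable {V W : Type*}

/-- Every nonempty vertex set of a `t`-tree has a vertex with at most `t` neighbors in it. -/
theorem IsKTreeOn.exists_card_le {r : ℕ} {s : Finset V} {H : SimpleGraph V}
    (h : IsKTreeOn r s H) {A : Finset V} (hA : A.Nonempty) (hAs : A ⊆ s) :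
    ∃ a ∈ A, ∀ B ⊆ A, (∀ b ∈ B, H.Adj a b) → B.card ≤ r := by
  induction h generalizing A with
  | clique s hs =>
    obtain ⟨a, ha⟩ := hA
    exact ⟨a, ha, fun B hB _ => (Finset.card_le_card (hB.trans hAs)).trans hs.le⟩
  | addVertex hH v hv K hKs hK ih =>
    -- If the last vertex `v` lies in `A`, all its neighbors are in the clique `K`. Otherwise
    -- removing `v` loses no edge inside `A`.
    by_cases hvA : v ∈ A
    · refine ⟨v, hvA, fun B hB hadj => (Finset.card_le_card fun b hb => ?_).trans hK.card_eq.le⟩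
      have := hadj b hb
      rw [sup_adj, fromRel_adj] at this
      rcases this with h | ⟨h1, ⟨-, h⟩ | ⟨h, -⟩⟩
      · exact absurd (hH.mem_of_adj _ _ h) hv
      · exact h
      · exact absurd h.symm h1
    · have hne : ∀ x ∈ A, x ≠ v := fun x hx h => hvA (h ▸ hx)
      obtain ⟨a, ha, h⟩ := ih hA fun x hx => (Finset.mem_cons.1 (hAs hx)).resolve_left (hne x hx)
      refine ⟨a, ha, fun B hB hadj => h B hB fun b hb => ?_⟩
      have := hadj b hb
      rw [sup_adj, fromRel_adj] at this
      rcases this with h | ⟨-, ⟨h, -⟩ | ⟨h, -⟩⟩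
      · exact h
      · exact absurd h (hne a ha)
      · exact absurd h (hne b (hB hb))

theorem IsPartialKTree.le_of_forall_exists_adj {r t : ℕ} {G : SimpleGraph V}
    (h : IsPartialKTree r G) {C : Finset V} (hC : C.Nonempty)
    (hdeg : ∀ c ∈ C, ∃ B ⊆ C, B.card = t ∧ ∀ b ∈ B, G.Adj c b) : t ≤ r := by
  obtain ⟨n, H, ⟨s, hs, hH⟩, ⟨φ⟩⟩ := h
  let e : V ↪ Fin n := ⟨φ, φ.injective⟩
  obtain ⟨a, ha, hle⟩ := hH.exists_card_le (hC.map (f := e)) fun x _ => hs x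
  obtain ⟨c, hc, rfl⟩ := Finset.mem_map.1 ha
  obtain ⟨B, hB, hBt, hadj⟩ := hdeg c hc
  rw [← hBt, ← Finset.card_map e]
  refine hle _ (Finset.map_subset_map.2 hB) fun b hb => ?_
  obtain ⟨b', hb', rfl⟩ := Finset.mem_map.1 hb
  exact φ.toHom.map_adj (hadj b' hb')

theorem IsKTreeOn.comap {t : ℕ} {s : Finset W} {H : SimpleGraph W} (h : IsKTreeOn t s H)
    (e : V ↪ W) {s' : Finset V} (hs : s = s'.map e) : IsKTreeOn t s' (H.comap e) := by
  induction h generalizing s' with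
  | clique s hc =>
    subst hs
    rw [Finset.card_map] at hc
    convert IsKTreeOn.clique s' hc using 1
    ext a b
    simp
  | @addVertex s H hH v hv K hKs hK ih =>
    classical
    have hvs : v ∈ s'.map e := by
      rw [← hs]
      simp
    obtain ⟨v', hv's, rfl⟩ := Finset.mem_map.1 hvs
    have hs2 : s = (s'.erase v').map e := by
      rw [Finset.map_erase, ← hs, Finset.cons_eq_insert, Finset.erase_insert hv]
    obtain ⟨K', hK's, rfl⟩ := Finset.subset_map_iff.1 (hs2 ▸ hKs)
    have hcl : (H.comap e).IsNClique t K' := by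
      refine ⟨fun a ha b hb hab => ?_, by rw [← hK.card_eq, Finset.card_map]⟩
      exact hK.isClique (Finset.mem_coe.2 (Finset.mem_map_of_mem e ha))
        (Finset.mem_coe.2 (Finset.mem_map_of_mem e hb)) (e.injective.ne hab)
    have hs' : s' = Finset.cons v' (s'.erase v') (Finset.notMem_erase v' s') := by
      rw [Finset.cons_eq_insert, Finset.insert_erase hv's]
    rw [hs']
    convert IsKTreeOn.addVertex (ih hs2) v' (Finset.notMem_erase v' s') K' hK's hcl using 1
    ext a b
    simp

end Treewidth

/-! ### An `ω`-clique and a copy of `K_{t,t}` in the tower -/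

namespace IsUniversalTower

open MeasureTheory

variable {t ω : ℕ} {s : ℕ → Finset ℕ} {H G : SimpleGraph ℕ}

theorem Extendable.level_mono (hU : IsUniversalTower t ω s H G) {d e : ℕ} (hde : d ≤ e)
    {T : Finset ℕ} (h : Extendable t s H d T) : Extendable t s H e T := by
  obtain ⟨K, h1, h2⟩ := h
  exact ⟨K, h1.trans (hU.monotone hde), h2⟩

theorem Extendable.subset {d : ℕ} {T : Finset ℕ} (h : Extendable t s H d T) : T ⊆ s d := by
  obtain ⟨K, h1, -, -, h4⟩ := h
  exact h4.trans h1

theorem exists_isNClique_graph (hU : IsUniversalTower t ω s H G) (hup : ω ≤ t) :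
    ∃ d, ∃ W ⊆ s d, G.IsNClique ω W := by
  obtain ⟨W, hW, -, -, hc, -⟩ := hU.exists_clique (r := 0) hU.extendable_empty subset_rfl
    (by simp) ω (by omega) (by simp; omega)
  exact ⟨_, W, hW, hc⟩

theorem exists_indep (hU : IsUniversalTower t ω s H G) (hω : 1 ≤ ω) (k : ℕ) (hk : k ≤ t) :
    ∃ A, Extendable t s H k A ∧ A.card = k ∧ ∀ a ∈ A, ∀ b ∈ A, ¬ G.Adj a b := by
  induction k with
  | zero => exact ⟨∅, hU.extendable_empty, by simp, by simp⟩
  | succ k ih =>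
    obtain ⟨A, hA, hc, hi⟩ := ih (by omega)
    obtain ⟨w, hw, hwd, hwe, hwg⟩ := hU.exists_vertex hA (by omega) (Finset.empty_subset A)
      (by simp; omega)
    refine ⟨insert w A, hwe, ?_, fun a ha b hb hab => ?_⟩
    · rw [Finset.card_insert_of_notMem fun h => hwd (hA.subset h), hc]
    · rcases Finset.mem_insert.1 ha with rfl | ha' <;> rcases Finset.mem_insert.1 hb with rfl | hb'
      · exact hab.ne rfl
      · simpa using (hwg b hb').1 hab
      · simpa using (hwg a ha').1 hab.symm
      · exact hi a ha' b hb' hab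

/-- `C` consists of an independent extendable `t`-set `A` and `t` further vertices, each joined to
all of `A`. These attachments are admissible because `A` spans no edge and `2 ≤ ω`. -/
theorem exists_degree_eq (hU : IsUniversalTower t ω s H G) (hω : 2 ≤ ω) (ht : 1 ≤ t) :
    ∃ d, ∃ C ⊆ s d, C.Nonempty ∧ ∀ c ∈ C, ∃ B ⊆ C, B.card = t ∧ ∀ b ∈ B, G.Adj c b := by
  obtain ⟨A, hA, hAt, hAi⟩ := hU.exists_indep (by omega) t le_rfl
  have key : ∀ k, ∃ B ⊆ s (t + k), B.card = k ∧ ∀ a ∈ A, ∀ b ∈ B, G.Adj b a := by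
    intro k
    induction k with
    | zero => exact ⟨∅, by simp, by simp, by simp⟩
    | succ k ih =>
      obtain ⟨B, hB, hBc, hBA⟩ := ih
      obtain ⟨w, hw, hwd, -, hwg⟩ := hU.exists_vertex (hA.level_mono hU (Nat.le_add_right t k))
        hAt.le subset_rfl (fun Q hQ hc => by
          obtain ⟨a, ha, b, hb, hab⟩ := Finset.one_lt_card.1 (by rw [hc.card_eq]; omega)
          exact hAi a (hQ ha) b (hQ hb) (hc.isClique ha hb hab))
      refine ⟨insert w B, Finset.insert_subset hw (hB.trans (hU.monotone (Nat.le_succ _))),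
        ?_, fun a ha b hb => ?_⟩
      · rw [Finset.card_insert_of_notMem fun h => hwd (hB h), hBc]
      · rcases Finset.mem_insert.1 hb with rfl | hb
        · exact (hwg a ha).2 ha
        · exact hBA a ha b hb
  obtain ⟨B, hB, hBc, hBA⟩ := key t
  refine ⟨t + t, A ∪ B, Finset.union_subset (hA.level_mono hU (Nat.le_add_right t t)).subset hB,
    ?_, fun c hc => ?_⟩
  · exact (Finset.card_pos.1 (by omega : 0 < A.card)).mono Finset.subset_union_left
  · rcases Finset.mem_union.1 hc with hc | hc
    · exact ⟨B, Finset.subset_union_right, hBc, fun b hb => (hBA c hc b hb).symm⟩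
    · exact ⟨A, Finset.subset_union_left, hAt, fun a ha => hBA a ha c hc⟩

end IsUniversalTower

end SimpleGraph

/-! ### Lower bound: fractional colorings of the tower -/

namespace SimpleGraph

open MeasureTheory

/-- `φ` is a fractional coloring of the subgraph of `G` induced on `A`. -/
structure IsFractionalColoringOn {V : Type*} (G : SimpleGraph V) (A : Finset V)
    (φ : V → Set ℝ) : Prop where
  measurable : ∀ v ∈ A, NullMeasurableSet (φ v) volume
  measure_eq_one : ∀ v ∈ A, volume (φ v) = 1
  disjoint : ∀ u ∈ A, ∀ v ∈ A, G.Adj u v → Disjoint (φ u) (φ v)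

namespace IsFractionalColoringOn

variable {V : Type*} {G : SimpleGraph V} {A : Finset V} {φ : V → Set ℝ}

theorem subset (h : G.IsFractionalColoringOn A φ) {B : Finset V} (hB : B ⊆ A) :
    G.IsFractionalColoringOn B φ :=
  ⟨fun v hv => h.measurable v (hB hv), fun v hv => h.measure_eq_one v (hB hv),
    fun u hu v hv => h.disjoint u (hB hu) v (hB hv)⟩

theorem measureReal_eq_one (h : G.IsFractionalColoringOn A φ) {v : V} (hv : v ∈ A) :
    volume.real (φ v) = 1 := by
  rw [Measure.real, h.measure_eq_one v hv, ENNReal.toReal_one]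

theorem measure_ne_top (h : G.IsFractionalColoringOn A φ) {v : V} (hv : v ∈ A) :
    volume (φ v) ≠ ⊤ := by
  rw [h.measure_eq_one v hv]
  exact ENNReal.one_ne_top

theorem measure_biUnion_ne_top (h : G.IsFractionalColoringOn A φ) {B : Finset V} (hB : B ⊆ A) :
    volume (⋃ v ∈ B, φ v) ≠ ⊤ := by
  refine ((measure_biUnion_finset_le B φ).trans_lt ?_).ne
  exact ENNReal.sum_lt_top.2 fun v hv => (h.measure_ne_top (hB hv)).lt_top

theorem nullMeasurableSet_biUnion (h : G.IsFractionalColoringOn A φ) {B : Finset V} (hB : B ⊆ A) :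
    NullMeasurableSet (⋃ v ∈ B, φ v) volume :=
  Finset.nullMeasurableSet_biUnion B fun v hv => h.measurable v (hB hv)

theorem disjoint_biUnion (h : G.IsFractionalColoringOn A φ) {B C : Finset V} (hB : B ⊆ A)
    (hC : C ⊆ A) (hadj : ∀ b ∈ B, ∀ c ∈ C, G.Adj b c) :
    Disjoint (⋃ v ∈ B, φ v) (⋃ v ∈ C, φ v) := by
  simp only [Set.disjoint_iUnion_left, Set.disjoint_iUnion_right]
  exact fun b hb c hc => h.disjoint c (hB hc) b (hC hb) (hadj c hc b hb)

theorem measureReal_union [DecidableEq V] (h : G.IsFractionalColoringOn A φ) {B C : Finset V}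
    (hB : B ⊆ A) (hC : C ⊆ A) (hadj : ∀ b ∈ B, ∀ c ∈ C, G.Adj b c) :
    volume.real (⋃ v ∈ B ∪ C, φ v) =
      volume.real (⋃ v ∈ B, φ v) + volume.real (⋃ v ∈ C, φ v) := by
  rw [Finset.set_biUnion_union]
  exact measureReal_union₀ (h.nullMeasurableSet_biUnion hC)
    (h.disjoint_biUnion hB hC hadj).aedisjoint (h.measure_biUnion_ne_top hB)
    (h.measure_biUnion_ne_top hC)

theorem measureReal_biUnion_clique (h : G.IsFractionalColoringOn A φ) {W : Finset V} {k : ℕ}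
    (hW : G.IsNClique k W) (hWA : W ⊆ A) : volume.real (⋃ v ∈ W, φ v) = k := by
  rw [measureReal_biUnion_finset₀ (fun a ha b hb hab =>
      (h.disjoint a (hWA ha) b (hWA hb) (hW.isClique ha hb hab)).aedisjoint)
    (fun v hv => h.measurable v (hWA hv)) (fun v hv => h.measure_ne_top (hWA hv)),
    Finset.sum_congr rfl fun v hv => h.measureReal_eq_one (hWA hv)]
  simp [hW.card_eq]

/-- Some vertex of a `k`-clique shares with a given vertex at most a `1 / k` part of its colors. -/
theorem exists_measureReal_inter_le (h : G.IsFractionalColoringOn A φ) {W : Finset V} {k : ℕ}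
    (hk : 0 < k) (hW : G.IsNClique k W) (hWA : W ⊆ A) {v : V} (hv : v ∈ A) :
    ∃ w ∈ W, volume.real (φ w ∩ φ v) ≤ 1 / k := by
  have hk' : (0 : ℝ) < k := by exact_mod_cast hk
  have hWne : W.Nonempty := Finset.card_pos.1 (by rw [hW.card_eq]; exact hk)
  -- Averaging: the sets `φ w ∩ φ v` are pairwise disjoint parts of `φ v`, so their measures sum to
  -- at most `1`.
  refine Finset.exists_le_of_sum_le hWne ?_
  rw [← measureReal_biUnion_finset₀ (fun a ha b hb hab => ((h.disjoint a (hWA ha) b (hWA hb)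
      (hW.isClique ha hb hab)).mono Set.inter_subset_left Set.inter_subset_left).aedisjoint)
    (fun w hw => (h.measurable w (hWA hw)).inter (h.measurable v hv))
    (fun w hw => ((measure_mono Set.inter_subset_left).trans_lt
      (h.measure_ne_top (hWA hw)).lt_top).ne)]
  calc volume.real (⋃ w ∈ W, φ w ∩ φ v) ≤ volume.real (φ v) :=
        measureReal_mono (Set.iUnion₂_subset fun w _ => Set.inter_subset_right)
          (h.measure_ne_top hv)
    _ = 1 := h.measureReal_eq_one hv
    _ = _ := by
      rw [Finset.sum_const, hW.card_eq, nsmul_eq_mul]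
      field_simp

end IsFractionalColoringOn

/-- A clique contains at most one of two nonadjacent vertices, so the pair costs only one in the
clique bound. -/
theorem cliqueFreeOn_insert_insert {V : Type*} [DecidableEq V] {G : SimpleGraph V} {A : Finset V}
    {n : ℕ} (h : G.CliqueFreeOn (A : Set V) n) {v w : V} (hvw : ¬ G.Adj w v) (hne : w ≠ v) :
    G.CliqueFreeOn ((insert w (insert v A) : Finset V) : Set V) (n + 1) := by
  intro Q hQ hc
  rw [Finset.coe_subset] at hQ
  by_cases hw : w ∈ Q
  · have hv : v ∉ Q := fun hv => hvw (hc.isClique hw hv hne)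
    refine cliqueFreeOn_insert h w (Finset.coe_subset.2 fun x hx => ?_) hc
    have := hQ hx
    simp only [Finset.mem_insert] at this ⊢
    have hxv : x ≠ v := fun h => hv (h ▸ hx)
    tauto
  · exact cliqueFreeOn_insert h v (Finset.coe_subset.2 fun x hx =>
      Finset.mem_of_mem_insert_of_ne (hQ hx) fun h => hw (h ▸ hx)) hc

namespace IsUniversalTower

variable {t ω : ℕ} {s : ℕ → Finset ℕ} {H G : SimpleGraph ℕ}

/-- The order of quantifiers is essential: `S` depends on the coloring, but the level `d` does not.
-/
theorem exists_large_biUnion (hU : IsUniversalTower t ω s H G) (hup : ω ≤ t)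
    (hlow : t + 1 ≤ 2 * ω) (i : ℕ) (hi : i ≤ t - ω + 1) :
    ∃ d, ∀ φ, G.IsFractionalColoringOn (s d) φ → ∃ S, Extendable t s H d S ∧ S.card = 2 * i ∧
      G.CliqueFreeOn (S : Set ℕ) (i + 1) ∧
      2 * (i : ℝ) - ∑ j ∈ Finset.Icc 1 i, 1 / ((ω : ℝ) - (j : ℝ) + 1) ≤
        volume.real (⋃ v ∈ S, φ v) := by
  induction i with
  | zero => exact ⟨0, fun φ _ => ⟨∅, hU.extendable_empty, by simp, by simp, by simp⟩⟩
  | succ i ih =>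
    obtain ⟨d, hd⟩ := ih (by omega)
    refine ⟨d + 1 + (ω - i), fun φ hφ => ?_⟩
    have hs1 : s d ⊆ s (d + 1) := hU.monotone d.le_succ
    have hs2 : s (d + 1) ⊆ s (d + 1 + (ω - i)) := hU.monotone (Nat.le_add_right _ _)
    obtain ⟨S, hS, hSc, hSf, hSv⟩ := hd φ (hφ.subset (hs1.trans hs2))
    obtain ⟨v, hv, hvd, hvS, hvadj⟩ := hU.exists_vertex hS (by omega) subset_rfl
      (hSf.mono G (by omega))
    -- `W` is joined to `S` but not to `v`. Its size `ω - i` is the largest allowed when `S` may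
    -- contain an `i`-clique.
    obtain ⟨W, hW, hWd, hWe, hWc, hWadj⟩ := hU.exists_clique hvS (Finset.subset_insert v S) hSf
      (ω - i) (by omega) (by
        have := Finset.card_insert_le v S
        omega)
    obtain ⟨w, hw, hwv⟩ := hφ.exists_measureReal_inter_le (by omega) hWc hW (hs2 hv)
    have hvS' : v ∉ S := fun h => hvd (hS.subset h)
    have hwd : w ∉ s (d + 1) := Finset.disjoint_left.1 hWd hw
    have hwne : w ≠ v := fun h => hwd (h ▸ hv)
    have hwS : w ∉ insert v S := by
      rw [Finset.mem_insert, not_or]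
      exact ⟨hwne, fun h => hwd (hs1 (hS.subset h))⟩
    have hnadj : ¬ G.Adj w v := fun h => hvS' ((hWadj w hw v (Finset.mem_insert_self v S)).1 h)
    refine ⟨insert w (insert v S), hWe.mono ?_, ?_, cliqueFreeOn_insert_insert hSf hnadj hwne, ?_⟩
    · exact Finset.insert_subset (Finset.mem_union_right _ hw) Finset.subset_union_left
    · rw [Finset.card_insert_of_notMem hwS, Finset.card_insert_of_notMem hvS', hSc]
      ring
    · have hpair : ({w, v} : Finset ℕ) ⊆ s (d + 1 + (ω - i)) := by
        intro x hx
        rcases Finset.mem_insert.1 hx with rfl | hx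
        · exact hW hw
        · rw [Finset.mem_singleton.1 hx]
          exact hs2 hv
      have hU2 : insert w (insert v S) = {w, v} ∪ S := by
        ext x
        simp
      have h1 : volume.real (⋃ x ∈ ({w, v} : Finset ℕ), φ x) + volume.real (φ w ∩ φ v) = 2 := by
        rw [Finset.set_biUnion_insert, Finset.set_biUnion_singleton,
          measureReal_union_add_inter₀ (hφ.measurable v (hs2 hv)) (hφ.measure_ne_top (hW hw))
            (hφ.measure_ne_top (hs2 hv)), hφ.measureReal_eq_one (hW hw),
          hφ.measureReal_eq_one (hs2 hv)]
        norm_num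
      rw [hU2, hφ.measureReal_union hpair (hS.subset.trans (hs1.trans hs2)),
        Finset.sum_Icc_succ_top (by omega)]
      · have h2 : (ω : ℝ) - ((i + 1 : ℕ) : ℝ) + 1 = ((ω - i : ℕ) : ℝ) := by
          rw [Nat.cast_sub (by omega)]
          push_cast
          ring
        rw [h2]
        push_cast
        linarith
      · intro b hb c hc
        rcases Finset.mem_insert.1 hb with rfl | hb
        · exact (hWadj b hw c (Finset.mem_insert_of_mem hc)).2 hc
        · rw [Finset.mem_singleton.1 hb]
          exact (hvadj c hc).2 hc

/-- A clique of `t + 1 - 2 * (t - ω + 1) = 2 * ω - t - 1` vertices joined to all of `S` adds its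
full size to the measure. By `hlow` the subtraction is not truncated, and `S` with this clique has
clique number at most `ω`. -/
theorem exists_le_measureReal (hU : IsUniversalTower t ω s H G) (hup : ω ≤ t)
    (hlow : t + 1 ≤ 2 * ω) :
    ∃ d, ∀ φ, G.IsFractionalColoringOn (s d) φ →
      (t : ℝ) + 1 - ∑ i ∈ Finset.Icc 1 (t - ω + 1), 1 / ((ω : ℝ) - (i : ℝ) + 1) ≤
        volume.real (⋃ v ∈ s d, φ v) := by
  obtain ⟨d, hd⟩ := hU.exists_large_biUnion hup hlow (t - ω + 1) le_rfl
  refine ⟨d + (t + 1 - 2 * (t - ω + 1)), fun φ hφ => ?_⟩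
  have hs : s d ⊆ s (d + (t + 1 - 2 * (t - ω + 1))) := hU.monotone (Nat.le_add_right _ _)
  obtain ⟨S, hS, hSc, hSf, hSv⟩ := hd φ (hφ.subset hs)
  obtain ⟨W, hW, -, -, hWc, hWadj⟩ := hU.exists_clique hS subset_rfl hSf
    (t + 1 - 2 * (t - ω + 1)) (by omega) (by omega)
  have hSs := hS.subset.trans hs
  have h1 := hφ.measureReal_union hW hSs fun b hb c hc => (hWadj b hb c hc).2 hc
  rw [hφ.measureReal_biUnion_clique hWc hW] at h1
  have h2 : volume.real (⋃ v ∈ W ∪ S, φ v) ≤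
      volume.real (⋃ v ∈ s (d + (t + 1 - 2 * (t - ω + 1))), φ v) :=
    measureReal_mono (Set.biUnion_subset_biUnion_left (Finset.union_subset hW hSs))
      (hφ.measure_biUnion_ne_top subset_rfl)
  have h3 : ((t + 1 - 2 * (t - ω + 1) : ℕ) : ℝ) = (t : ℝ) + 1 - 2 * ((t - ω + 1 : ℕ) : ℝ) := by
    rw [Nat.cast_sub (by omega)]
    push_cast
    ring
  linarith

end IsUniversalTower

/-! ### Passage to a finite graph and conclusion -/

theorem CliqueFreeOn.cliqueFree_comap {V W : Type*} {G : SimpleGraph W} {A : Finset W} {n : ℕ}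
    (h : G.CliqueFreeOn (A : Set W) n) (e : V ↪ W) (he : ∀ v, e v ∈ A) :
    (G.comap e).CliqueFree n := by
  intro Q hQ
  refine h (t := Q.map e) (fun x hx => ?_) ⟨fun a ha b hb hab => ?_, ?_⟩
  · obtain ⟨v, -, rfl⟩ := Finset.mem_map.1 (Finset.mem_coe.1 hx)
    exact he v
  · obtain ⟨u, hu, rfl⟩ := Finset.mem_map.1 (Finset.mem_coe.1 ha)
    obtain ⟨v, hv, rfl⟩ := Finset.mem_map.1 (Finset.mem_coe.1 hb)
    exact hQ.isClique hu hv fun h => hab (by rw [h])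
  · rw [Finset.card_map, hQ.card_eq]

theorem exists_le_fractionalChromaticNumber {t ω : ℕ} (hω : 2 ≤ ω) (hup : ω ≤ t)
    (hlow : t + 1 ≤ 2 * ω) :
    ∃ (n : ℕ) (G : SimpleGraph (Fin n)), G.treewidth = t ∧ G.cliqueNum = ω ∧
      (t : ℝ) + 1 - ∑ i ∈ Finset.Icc 1 (t - ω + 1), 1 / ((ω : ℝ) - (i : ℝ) + 1)
        ≤ G.fractionalChromaticNumber := by
  obtain ⟨s, H, G, hU⟩ := exists_isUniversalTower (t := t) (ω := ω) (by omega)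
  obtain ⟨d₁, W, hWs, hW⟩ := hU.exists_isNClique_graph hup
  obtain ⟨d₂, C, hCs, hC, hdeg⟩ := hU.exists_degree_eq hω (by omega)
  obtain ⟨d₃, hd₃⟩ := hU.exists_le_measureReal hup hlow
  -- One level containing the `ω`-clique, the treewidth obstruction and the level that forces the
  -- measure bound.
  let D := max d₁ (max d₂ d₃)
  have h1 : s d₁ ⊆ s D := hU.monotone (le_max_left _ _)
  have h2 : s d₂ ⊆ s D := hU.monotone ((le_max_left _ _).trans (le_max_right _ _))
  have h3 : s d₃ ⊆ s D := hU.monotone ((le_max_right _ _).trans (le_max_right _ _))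
  let e : Fin (s D).card ↪ ℕ := ((s D).orderEmbOfFin rfl).toEmbedding
  have he : ∀ v, e v ∈ s D := fun v => Finset.orderEmbOfFin_mem _ rfl v
  have hmap : s D = Finset.univ.map e := by
    refine (Finset.eq_of_subset_of_card_le (fun x hx => ?_) ?_).symm
    · obtain ⟨v, -, rfl⟩ := Finset.mem_map.1 hx
      exact he v
    · rw [Finset.card_map, Finset.card_univ, Fintype.card_fin]
  have hpartial : IsPartialKTree t (G.comap e) := by
    obtain ⟨H', hH', hGH⟩ := hU.exists_isKTreeOn D
    exact ⟨_, H'.comap e, ⟨Finset.univ, Finset.mem_univ, hH'.comap e hmap⟩,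
      ⟨⟨⟨id, fun {a b} hab => hGH _ (he a) _ (he b) hab⟩, Function.injective_id⟩⟩⟩
  refine ⟨(s D).card, G.comap e, le_antisymm (Nat.sInf_le hpartial) ?_, le_antisymm ?_ ?_, ?_⟩
  · refine le_csInf ⟨t, hpartial⟩ fun r hr => ?_
    obtain ⟨C', -, rfl⟩ := Finset.subset_map_iff.1 (hmap ▸ hCs.trans h2)
    refine IsPartialKTree.le_of_forall_exists_adj hr (Finset.map_nonempty.1 hC) fun c hc => ?_
    obtain ⟨B, hB, hBt, hadj⟩ := hdeg (e c) (Finset.mem_map_of_mem e hc)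
    obtain ⟨B', hB', rfl⟩ := Finset.subset_map_iff.1 hB
    exact ⟨B', hB', by rw [← hBt, Finset.card_map],
      fun b hb => hadj _ (Finset.mem_map_of_mem e hb)⟩
  · have hfree := (hU.cliqueFreeOn D).cliqueFree_comap e he
    obtain ⟨Q, hQ⟩ := (G.comap e).exists_isNClique_cliqueNum
    by_contra! hlt
    exact hfree.mono hlt Q hQ
  · obtain ⟨W', -, rfl⟩ := Finset.subset_map_iff.1 (hmap ▸ hWs.trans h1)
    rw [← hW.card_eq, Finset.card_map]
    refine IsClique.card_le_cliqueNum (tc := fun a ha b hb hab => ?_)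
    exact hW.isClique (Finset.mem_coe.2 (Finset.mem_map_of_mem e ha))
      (Finset.mem_coe.2 (Finset.mem_map_of_mem e hb)) (e.injective.ne hab)
  · refine le_fractionalChromaticNumber fun φ hφ => ?_
    -- `ψ` carries `φ` over along the injection `e` and is empty off its image.
    let ψ : ℕ → Set ℝ := fun x => ⋃ v, ⋃ _ : e v = x, φ v
    have hψ : ∀ v, ψ (e v) = φ v := by
      intro v
      ext y
      simp [ψ]
    have hcol : G.IsFractionalColoringOn (s D) ψ := by
      have hex : ∀ x ∈ s D, ∃ v, e v = x := fun x hx => by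
        rw [hmap] at hx
        obtain ⟨v, -, h⟩ := Finset.mem_map.1 hx
        exact ⟨v, h⟩
      refine ⟨fun x hx => ?_, fun x hx => ?_, fun x hx y hy hxy => ?_⟩
      · obtain ⟨v, rfl⟩ := hex x hx
        rw [hψ]
        exact hφ.measurable v
      · obtain ⟨v, rfl⟩ := hex x hx
        rw [hψ]
        exact hφ.measure_eq_one v
      · obtain ⟨u, rfl⟩ := hex x hx
        obtain ⟨v, rfl⟩ := hex y hy
        rw [hψ, hψ]
        exact hφ.disjoint u v hxy
    have hun : ⋃ x ∈ s D, ψ x = ⋃ v, φ v := by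
      conv_lhs => rw [hmap]
      simp [hψ]
    refine (hd₃ ψ (hcol.subset h3)).trans ?_
    refine (measureReal_mono (s₂ := ⋃ x ∈ s D, ψ x) (Set.biUnion_subset_biUnion_left h3)
      (hcol.measure_biUnion_ne_top subset_rfl)).trans ?_
    rw [hun, Measure.real]

theorem fractionalChromaticNumber_le_of_treewidth_eq {V : Type*} [Finite V] {t : ℕ} (ht : 1 ≤ t)
    {G : SimpleGraph V} (htw : G.treewidth = t) (hc : G.cliqueNum = t) :
    G.fractionalChromaticNumber ≤ (t : ℝ) + 1 - 1 / t := by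
  have hmem : IsPartialKTree G.treewidth G := by
    refine Nat.sInf_mem (s := {t : ℕ | IsPartialKTree t G}) ?_
    -- If no width were possible, `sInf` would take the default value `0`, contrary to `1 ≤ t`.
    by_contra hne
    rw [Set.not_nonempty_iff_eq_empty] at hne
    rw [treewidth, hne, Nat.sInf_empty] at htw
    omega
  rw [htw] at hmem
  refine hmem.fractionalChromaticNumber_le ht fun Q hQ => ?_
  have := IsClique.card_le_cliqueNum (tc := hQ.isClique)
  rw [hQ.card_eq] at this
  omega

end SimpleGraph

theorem mainTheorem4 (t ω : ℕ) (ht : 1 ≤ t) (hω : 2 ≤ ω)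
    (hlow : ((t : ℝ) + 1) / 2 ≤ (ω : ℝ)) (hup : ω ≤ t) :
    (∃ (n : ℕ) (G : SimpleGraph (Fin n)), G.treewidth = t ∧ G.cliqueNum = ω ∧
      (t : ℝ) + 1 - ∑ i ∈ Finset.Icc 1 (t - ω + 1), 1 / ((ω : ℝ) - (i : ℝ) + 1)
        ≤ G.fractionalChromaticNumber) ∧
    (ω = t →
      IsGreatest
        {x : ℝ | ∃ (n : ℕ) (G : SimpleGraph (Fin n)), G.treewidth = t ∧ G.cliqueNum = t ∧
          G.fractionalChromaticNumber = x}
        ((t : ℝ) + 1 - 1 / (t : ℝ))) := by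
  have hlow' : t + 1 ≤ 2 * ω := by
    have : (t : ℝ) + 1 ≤ 2 * ω := by linarith
    exact_mod_cast this
  have hex := SimpleGraph.exists_le_fractionalChromaticNumber hω hup hlow'
  refine ⟨hex, ?_⟩
  rintro rfl
  obtain ⟨n, G, htw, hc, hle⟩ := hex
  refine ⟨⟨n, G, htw, hc, le_antisymm
    (SimpleGraph.fractionalChromaticNumber_le_of_treewidth_eq ht htw hc) ?_⟩, ?_⟩
  -- For `ω = t` the sum has the single term `i = 1`, equal to `1 / t`.
  · simpa using hle
  · rintro _ ⟨m, F, htw, hc, rfl⟩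
    exact SimpleGraph.fractionalChromaticNumber_le_of_treewidth_eq ht htw hc
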